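/- A zero-dimensional system $(X,f)$ is a compact, totally disconnected metric space $X$ together with a continuous surjection $f:X\to X$. It is chain transitive if for every $\epsilon>0$ and all $x,y\in X$ there are $l\ge 1$ and points $x=x_0,x_1,\dots,x_l=y$ with $d(f(x_i),x_{i+1})<\epsilon$ for $0\le i<l$. A subset $A\subset X$ is (positively) uniformly proximal if $\liminf_{n\to+\infty}\operatorname{diam}(f^n(A))=0$, and negatively uniformly proximal if $\liminf_{n\to+\infty}\operatorname{diam}(f^{-n}(A))=0$, where $f^{-n}(A)$ is the preimage of $A$ under $f^n$. It is (positively) uniformly recurrent if for every $\epsilon>0$ there are arbitrarily large $n>0$ such that $d(f^n(x),x)<\epsilon$ for all $x\in A$, and negatively uniformly recurrent if for every $\epsilon>0$ there are arbitrarily large $n>0$ such that $d(y,x)<\epsilon$ for all $x\in A$ and all $y\in f^{-n}(x)$. A point $x$ is positively transitive if $\{f^n(x): n\ge 0\}$ is dense in $X$, and negatively transitive if every backward orbit of $x$ (a sequence $x=b_0,b_1,b_2,\dots$ with $f(b_{n+1})=b_n$ for all $n$) is dense in $X$. A Cantor set is a subset homeomorphic to $\{0,1\}^{\mathbb N}$.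 A uniformly chaotic set is a set $K\subset X$ that is the union of a sequence $C_1\subset C_2\subset\cdots$ of Cantor sets each of which is uniformly recurrent and uniformly proximal; $(X,f)$ is densely uniformly chaotic if it has a dense uniformly chaotic set. **Theorem.** Let $(Y,g)$ be a chain transitive zero-dimensional system. Then there exist a densely uniformly chaotic zero-dimensional system $(X,f)$, a topological embedding of $Y$ in $X$ (by which $Y$ is regarded as a subset of $X$) with $f|_Y=g$, and a uniformly chaotic set $K\subset X\setminus Y$ such that 1. $f$ restricts to a homeomorphism of $X\setminus Y$ onto itself; 2. $K=\bigcup_{N\ge 1}C_N$, where $C_1\subset C_2\subset\cdots$ is an increasing sequence of Cantor sets; 3. each $C_N$ is both positively and negatively uniformly proximal; 4. each $C_N$ is both positively and negatively uniformly recurrent; 5. $f(K)=K$; 6. $K$ is dense in $X$; 7. each $x\in K$ is both positively and negatively transitive. (By 1, points of $X\setminus Y$ have exactly one preimage under each $f^n$, and it lies in $X\setminus Y$, so the negative notions for $C_N$ and for points of $K$ refer to the iterates of the inverse homeomorphism.) -/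

import Mathlib

open Filter Set

universe u

/-- `(X, f)` is a zero-dimensional system: `X` is a compact, totally disconnected metric space and
`f` is a continuous surjection of `X` onto itself. -/
structure IsZeroDimSystem {X : Type u} [MetricSpace X] (f : X → X) : Prop where
  compactSpace : CompactSpace X
  totallyDisconnectedSpace : TotallyDisconnectedSpace X
  continuous : Continuous f
  surjective : Function.Surjective f

/-- Any two points are joined by an `ε`-chain `x = c 0, c 1, …, c l = y`, for every `ε > 0`. -/
def IsChainTransitive {X : Type u} [MetricSpace X] (f : X → X) : Prop :=
  ∀ ε : ℝ, 0 < ε → ∀ x y : X, ∃ (l : ℕ) (c : ℕ → X),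
    0 < l ∧ c 0 = x ∧ c l = y ∧ ∀ i < l, dist (f (c i)) (c (i + 1)) < ε

/-- A subset that is homeomorphic, in its subspace topology, to the Cantor space `{0,1}^ℕ`. -/
def IsCantorSet {X : Type u} [TopologicalSpace X] (C : Set X) : Prop :=
  Nonempty (C ≃ₜ (ℕ → Bool))

/-- (Positive) uniform proximality: `liminf diam (f^n (A)) = 0` as `n → +∞`. -/
def IsUniformlyProximal {X : Type u} [MetricSpace X] (f : X → X) (A : Set X) : Prop :=
  liminf (fun n : ℕ => Metric.ediam (f^[n] '' A)) atTop = 0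

/-- Negative uniform proximality: `liminf diam (f^(-n) (A)) = 0` as `n → +∞`, where `f^(-n) (A)`
is the full preimage of `A` under `f^n`. -/
def IsNegUniformlyProximal {X : Type u} [MetricSpace X] (f : X → X) (A : Set X) : Prop :=
  liminf (fun n : ℕ => Metric.ediam (f^[n] ⁻¹' A)) atTop = 0

/-- (Positive) uniform recurrence: for every `ε > 0` there are arbitrarily large `n > 0` such that
`d (f^n (x), x) < ε` for all `x ∈ A`. -/
def IsUniformlyRecurrent {X : Type u} [MetricSpace X] (f : X → X) (A : Set X) : Prop :=
  ∀ ε : ℝ, 0 < ε → ∀ m : ℕ, ∃ n > m, ∀ x ∈ A, dist (f^[n] x) x < ε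

/-- Negative uniform recurrence: for every `ε > 0` there are arbitrarily large `n > 0` such that,
for all `x ∈ A`, every point of `f^(-n) (x)` is at distance less than `ε` from `x`. -/
def IsNegUniformlyRecurrent {X : Type u} [MetricSpace X] (f : X → X) (A : Set X) : Prop :=
  ∀ ε : ℝ, 0 < ε → ∀ m : ℕ, ∃ n > m, ∀ x ∈ A, ∀ y : X, f^[n] y = x → dist y x < ε

/-- `x` is positively transitive: its forward orbit is dense. -/
def IsPosTransitivePoint {X : Type u} [TopologicalSpace X] (f : X → X) (x : X) : Prop :=
  Dense (range fun n : ℕ => f^[n] x)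

/-- `x` is negatively transitive: its backward orbit is dense. When `f` is not injective this is
asked of every backward orbit `x = b 0, b 1, b 2, …` with `f (b (n + 1)) = b n`. -/
def IsNegTransitivePoint {X : Type u} [TopologicalSpace X] (f : X → X) (x : X) : Prop :=
  ∀ b : ℕ → X, b 0 = x → (∀ n, f (b (n + 1)) = b n) → Dense (range b)

/-- A uniformly chaotic set: an increasing union of a sequence of Cantor sets, each of which is
uniformly recurrent and uniformly proximal. -/
def IsUniformlyChaoticSet {X : Type u} [MetricSpace X] (f : X → X) (K : Set X) : Prop :=
  ∃ C : ℕ → Set X, Monotone C ∧ (∀ N, IsCantorSet (C N)) ∧ K = ⋃ N, C N ∧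
    (∀ N, IsUniformlyRecurrent f (C N)) ∧ (∀ N, IsUniformlyProximal f (C N))

/-- The system has a dense uniformly chaotic subset. -/
def IsDenselyUniformlyChaotic {X : Type u} [MetricSpace X] (f : X → X) : Prop :=
  ∃ K : Set X, Dense K ∧ IsUniformlyChaoticSet f K

/-! Take the two-sided sequences over `Y ⊕ Bool` made of orbit pieces of `g` separated by breaks,
and identify unbroken sequences that have the same entry at 0. The unbroken classes form a copy of
`(Y, g)`: every point lies on a full orbit, and in an unbroken sequence the entry at 0 determines
the future. All other classes are singletons, and on them the shift is invertible.

Chaos comes from one recursive construction (`stage`, `limitOrbit`). With L = 13^k, the block on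
[-L, L] is extended to [-13L, 13L] by copies of itself at ±4L, words from a dense sequence at ±7L,
marks at ±9L, and `false` elsewhere. The copies give recurrence at time 4L, the runs of `false`
around ±11L give proximality to `allFalse`, and the words give transitivity in both directions.
These times of recurrence and proximality do not depend on the bits `s`. The mark `true` at 9L pins
down the origin and the mark `s k` at -9L records the bits, so shifts by different amounts or with
different bits are different points. `IsChaoticFamily` collects these properties; its windows |i| ≤
N are the Cantor sets. -/

/-! ### Finite multiples of the Cantor space -/

/-- Prepending a bit identifies `Bool × {0,1}^ℕ` with `{0,1}^ℕ`. -/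
def boolProdCantor : Bool × (ℕ → Bool) ≃ₜ (ℕ → Bool) where
  toFun p n := Nat.casesOn n p.1 p.2
  invFun s := (s 0, fun n => s (n + 1))
  left_inv _ := rfl
  right_inv s := by
    funext n
    cases n <;> rfl
  continuous_toFun := by
    refine continuous_pi fun n => ?_
    cases n with
    | zero => exact continuous_fst
    | succ n => exact (continuous_apply n).comp continuous_snd
  continuous_invFun := by fun_prop

theorem nonempty_homeomorph_fin_prod_cantor (n : ℕ) :
    Nonempty (Fin (n + 1) × (ℕ → Bool) ≃ₜ (ℕ → Bool)) := by
  induction n with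
  | zero => exact ⟨Homeomorph.uniqueProd (Fin 1) (ℕ → Bool)⟩
  | succ n ih =>
    obtain ⟨e⟩ := ih
    let d : Fin (n + 1 + 1) ≃ₜ Fin (n + 1) ⊕ Fin 1 := finSumFinEquiv.symm.toHomeomorphOfDiscrete
    let b : Bool ≃ₜ Unit ⊕ Unit := Equiv.boolEquivPUnitSumPUnit.toHomeomorphOfDiscrete
    let C := ℕ → Bool
    exact ⟨((d.prodCongr (Homeomorph.refl C)).trans Homeomorph.sumProdDistrib).trans
      ((e.sumCongr (Homeomorph.uniqueProd (Fin 1) C)).trans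
        (((Homeomorph.uniqueProd Unit C).symm.sumCongr (Homeomorph.uniqueProd Unit C).symm).trans
          (Homeomorph.sumProdDistrib.symm.trans
            ((b.symm.prodCongr (Homeomorph.refl C)).trans boolProdCantor))))⟩

theorem nonempty_homeomorph_prod_cantor (F : Type*) [Fintype F] [Nonempty F] [TopologicalSpace F]
    [DiscreteTopology F] : Nonempty (F × (ℕ → Bool) ≃ₜ (ℕ → Bool)) := by
  obtain ⟨n, hn⟩ := Nat.exists_eq_succ_of_ne_zero (Fintype.card_ne_zero (α := F))
  obtain ⟨e⟩ := nonempty_homeomorph_fin_prod_cantor n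
  exact ⟨((Fintype.equivFinOfCardEq hn).toHomeomorphOfDiscrete.prodCongr
    (Homeomorph.refl _)).trans e⟩

/-! ### Chaotic families of orbits and their consequences -/

/-- A family of full orbits of `f`, parametrized continuously and injectively by the Cantor space,
that are transitive in both directions, and that are recurrent and proximal to a point at times
independent of the parameter. -/
structure IsChaoticFamily {X : Type u} [MetricSpace X] (f : X → X) (P : ℤ → (ℕ → Bool) → X) :
    Prop where
  continuous : ∀ i, Continuous (P i)
  injective : ∀ i j s t, P i s = P j t → i = j ∧ s = t
  map_eq : ∀ i s, f (P i s) = P (i + 1) s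
  eq_of_map_eq : ∀ i s y, f y = P (i + 1) s → y = P i s
  recurrent : ∀ ε : ℝ, 0 < ε → ∀ N m : ℕ, ∃ n > m, ∀ i s, |i| ≤ (N : ℤ) →
    dist (P (i + n) s) (P i s) < ε ∧ dist (P (i - n) s) (P i s) < ε
  proximal : ∃ p, ∀ ε : ℝ, 0 < ε → ∀ N m : ℕ, ∃ n > m, ∀ i s, |i| ≤ (N : ℤ) →
    dist (P (i + n) s) p < ε ∧ dist (P (i - n) s) p < ε
  transitive : ∀ U : Set X, IsOpen U → U.Nonempty → ∀ s, ∀ m : ℤ,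
    (∃ n ≥ m, P n s ∈ U) ∧ (∃ n ≤ m, P n s ∈ U)

namespace IsChaoticFamily

/-- The members of the family at the times in `[-N, N]`. -/
def window {X : Type u} (P : ℤ → (ℕ → Bool) → X) (N : ℕ) : Set X :=
  {x | ∃ i s, |i| ≤ (N : ℤ) ∧ x = P i s}

theorem window_mono {X : Type u} {P : ℤ → (ℕ → Bool) → X} : Monotone (window P) := by
  rintro M N h x ⟨i, s, hi, rfl⟩
  exact ⟨i, s, hi.trans (by exact_mod_cast h), rfl⟩

theorem iUnion_window {X : Type u} {P : ℤ → (ℕ → Bool) → X} :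
    ⋃ N, window P N = range fun p : ℤ × (ℕ → Bool) => P p.1 p.2 := by
  ext x
  simp only [mem_iUnion, mem_range, Prod.exists]
  constructor
  · rintro ⟨N, i, s, -, rfl⟩
    exact ⟨i, s, rfl⟩
  · rintro ⟨i, s, rfl⟩
    exact ⟨i.natAbs, i, s, by simp, rfl⟩

variable {X : Type u} [MetricSpace X] {f : X → X} {P : ℤ → (ℕ → Bool) → X}

/-- Injectivity in the pair (time, parameter) keeps the finitely many Cantor sets of the window
disjoint, so their union is a finite set times the Cantor space. -/
theorem isCantorSet_window (h : IsChaoticFamily f P) (N : ℕ) : IsCantorSet (window P N) := by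
  let F := Finset.Icc (-(N : ℤ)) N
  have : Nonempty F := ⟨⟨0, by simp [F]⟩⟩
  obtain ⟨e⟩ := nonempty_homeomorph_prod_cantor F
  let Q : F × (ℕ → Bool) → X := fun p => P p.1 p.2
  have hc : Continuous Q := continuous_prod_of_discrete_left.2 fun i => h.continuous i
  have hi : Function.Injective Q := by
    rintro ⟨i, s⟩ ⟨j, t⟩ hij
    obtain ⟨h1, h2⟩ := h.injective _ _ _ _ hij
    exact Prod.ext (Subtype.ext h1) h2
  have hr : range Q = window P N := by
    ext x
    constructor
    · rintro ⟨⟨⟨i, hi⟩, s⟩, rfl⟩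
      exact ⟨i, s, abs_le.2 (Finset.mem_Icc.1 hi), rfl⟩
    · rintro ⟨i, s, hi, rfl⟩
      exact ⟨⟨⟨i, Finset.mem_Icc.2 (abs_le.1 hi)⟩, s⟩, rfl⟩
  have he : Topology.IsEmbedding Q := (hc.isClosedEmbedding hi).isEmbedding
  exact ⟨(Homeomorph.setCongr hr.symm).trans (he.toHomeomorph.symm.trans e)⟩

theorem iterate_eq (h : IsChaoticFamily f P) (n : ℕ) (i : ℤ) (s : ℕ → Bool) :
    f^[n] (P i s) = P (i + n) s := by
  induction n with
  | zero => simp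
  | succ n ih =>
    rw [Function.iterate_succ_apply', ih, h.map_eq]
    push_cast
    rw [add_assoc]

/-- Points of the family have a unique preimage, so full preimages under `f^[n]` merely lower the
time index. All negative notions reduce to this. -/
theorem eq_of_iterate_eq (h : IsChaoticFamily f P) (n : ℕ) (i : ℤ) (s : ℕ → Bool) (y : X)
    (hy : f^[n] y = P i s) : y = P (i - n) s := by
  induction n generalizing i with
  | zero => simpa using hy
  | succ n ih =>
    rw [Function.iterate_succ_apply'] at hy
    have := ih (i - 1) (h.eq_of_map_eq _ _ _ (by rwa [sub_add_cancel]))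
    rw [this]
    congr 1
    push_cast
    ring

theorem liminf_ediam_eq_zero {A : ℕ → Set X} {p : X}
    (hA : ∀ ε : ℝ, 0 < ε → ∀ m : ℕ, ∃ n > m, ∀ x ∈ A n, dist x p < ε) :
    liminf (fun n => Metric.ediam (A n)) atTop = 0 := by
  refine le_antisymm (ENNReal.le_of_forall_pos_le_add fun ε hε _ => ?_) bot_le
  rw [zero_add]
  refine liminf_le_of_frequently_le' (frequently_atTop.2 fun m => ?_)
  obtain ⟨n, hn, h⟩ := hA (ε / 2) (by positivity) m
  refine ⟨n, hn.le, Metric.ediam_le fun x hx y hy => ?_⟩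
  rw [edist_dist, ← ENNReal.ofReal_coe_nnreal]
  refine ENNReal.ofReal_le_ofReal ?_
  have := dist_triangle_right x y p
  have := h x hx
  have := h y hy
  linarith

theorem isUniformlyProximal_window (h : IsChaoticFamily f P) (N : ℕ) :
    IsUniformlyProximal f (window P N) := by
  obtain ⟨p, hp⟩ := h.proximal
  refine liminf_ediam_eq_zero (p := p) fun ε hε m => ?_
  obtain ⟨n, hn, H⟩ := hp ε hε N m
  refine ⟨n, hn, ?_⟩
  rintro _ ⟨_, ⟨i, s, hi, rfl⟩, rfl⟩
  rw [h.iterate_eq]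
  exact (H i s hi).1

theorem isNegUniformlyProximal_window (h : IsChaoticFamily f P) (N : ℕ) :
    IsNegUniformlyProximal f (window P N) := by
  obtain ⟨p, hp⟩ := h.proximal
  refine liminf_ediam_eq_zero (p := p) fun ε hε m => ?_
  obtain ⟨n, hn, H⟩ := hp ε hε N m
  refine ⟨n, hn, ?_⟩
  rintro y ⟨i, s, hi, hy⟩
  rw [h.eq_of_iterate_eq _ _ _ _ hy]
  exact (H i s hi).2

theorem isUniformlyRecurrent_window (h : IsChaoticFamily f P) (N : ℕ) :
    IsUniformlyRecurrent f (window P N) := by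
  intro ε hε m
  obtain ⟨n, hn, H⟩ := h.recurrent ε hε N m
  refine ⟨n, hn, ?_⟩
  rintro _ ⟨i, s, hi, rfl⟩
  rw [h.iterate_eq]
  exact (H i s hi).1

theorem isNegUniformlyRecurrent_window (h : IsChaoticFamily f P) (N : ℕ) :
    IsNegUniformlyRecurrent f (window P N) := by
  intro ε hε m
  obtain ⟨n, hn, H⟩ := h.recurrent ε hε N m
  refine ⟨n, hn, ?_⟩
  rintro _ ⟨i, s, hi, rfl⟩ y hy
  rw [h.eq_of_iterate_eq _ _ _ _ hy]
  exact (H i s hi).2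

theorem isPosTransitivePoint (h : IsChaoticFamily f P) (i : ℤ) (s : ℕ → Bool) :
    IsPosTransitivePoint f (P i s) := by
  refine dense_iff_inter_open.2 fun U hU hne => ?_
  obtain ⟨⟨n, hn, hnU⟩, -⟩ := h.transitive U hU hne s i
  obtain ⟨k, rfl⟩ := Int.le.dest hn
  exact ⟨_, hnU, k, h.iterate_eq k i s⟩

theorem isNegTransitivePoint (h : IsChaoticFamily f P) (i : ℤ) (s : ℕ → Bool) :
    IsNegTransitivePoint f (P i s) := by
  intro b hb0 hb
  have hb' : ∀ n : ℕ, b n = P (i - n) s := by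
    intro n
    induction n with
    | zero => simpa using hb0
    | succ n ih =>
      refine h.eq_of_map_eq _ _ _ ?_
      rw [hb, ih]
      congr 1
      push_cast
      ring
  refine dense_iff_inter_open.2 fun U hU hne => ?_
  obtain ⟨-, ⟨n, hn, hnU⟩⟩ := h.transitive U hU hne s i
  obtain ⟨k, rfl⟩ := Int.le.dest hn
  refine ⟨_, hnU, k, ?_⟩
  rw [hb' k]
  congr 1
  ring

theorem dense_range (h : IsChaoticFamily f P) :
    Dense (range fun p : ℤ × (ℕ → Bool) => P p.1 p.2) := by
  refine dense_iff_inter_open.2 fun U hU hne => ?_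
  obtain ⟨⟨n, -, hnU⟩, -⟩ := h.transitive U hU hne (fun _ => false) 0
  exact ⟨_, hnU, (n, _), rfl⟩

theorem image_range (h : IsChaoticFamily f P) :
    f '' (range fun p : ℤ × (ℕ → Bool) => P p.1 p.2) =
      range fun p : ℤ × (ℕ → Bool) => P p.1 p.2 := by
  ext x
  constructor
  · rintro ⟨_, ⟨⟨i, s⟩, rfl⟩, rfl⟩
    exact ⟨(i + 1, s), (h.map_eq i s).symm⟩
  · rintro ⟨⟨i, s⟩, rfl⟩
    exact ⟨_, ⟨(i - 1, s), rfl⟩, by simp [h.map_eq]⟩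

theorem isUniformlyChaoticSet_range (h : IsChaoticFamily f P) :
    IsUniformlyChaoticSet f (range fun p : ℤ × (ℕ → Bool) => P p.1 p.2) :=
  ⟨window P, window_mono, h.isCantorSet_window, iUnion_window.symm, h.isUniformlyRecurrent_window,
    h.isUniformlyProximal_window⟩

end IsChaoticFamily

/-! ### The space of broken orbits and its quotient -/

/-- Two-sided sequences over `Y ⊕ Bool` whose maximal blocks in `Y` are pieces of orbits of `g`;
the entries in `Bool` are the breaks between these pieces. -/
def BrokenOrbit {Y : Type u} (g : Y → Y) : Type u :=
  {x : ℤ → Y ⊕ Bool // ∀ i y y', x i = Sum.inl y → x (i + 1) = Sum.inl y' → y' = g y}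

namespace BrokenOrbit

variable {Y : Type u} {g : Y → Y}

instance : CoeFun (BrokenOrbit g) fun _ => ℤ → Y ⊕ Bool := ⟨Subtype.val⟩

@[ext] theorem ext {x x' : BrokenOrbit g} (h : ∀ i, x i = x' i) : x = x' :=
  Subtype.ext (funext h)

/-- The sequence has at least one break. -/
def HasBreak (x : BrokenOrbit g) : Prop := ∃ i, (x i).isRight

/-- The shift by `j` places. -/
def shift (j : ℤ) (x : BrokenOrbit g) : BrokenOrbit g :=
  ⟨fun i => x (i + j), fun i y y' h h' => x.2 (i + j) y y' h (by rwa [add_right_comm])⟩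

@[simp] theorem shift_apply (j : ℤ) (x : BrokenOrbit g) (i : ℤ) : shift j x i = x (i + j) := rfl

theorem shift_shift (i j : ℤ) (x : BrokenOrbit g) : shift i (shift j x) = shift (i + j) x := by
  ext k
  simp [add_assoc]

@[simp] theorem shift_zero (x : BrokenOrbit g) : shift 0 x = x := by
  ext k
  simp

@[simp] theorem hasBreak_shift {j : ℤ} {x : BrokenOrbit g} : HasBreak (shift j x) ↔ HasBreak x :=
  ⟨fun ⟨i, hi⟩ => ⟨i + j, hi⟩, fun ⟨i, hi⟩ => ⟨i - j, by simpa using hi⟩⟩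

/-- The sequence without orbit pieces all of whose breaks are `false`. -/
def allFalse (g : Y → Y) : BrokenOrbit g := ⟨fun _ => Sum.inr false, by simp⟩

/-- Every point lies on a full orbit. -/
theorem exists_apply_zero_eq (hg : Function.Surjective g) (y : Y) :
    ∃ x : BrokenOrbit g, ¬ HasBreak x ∧ x 0 = Sum.inl y := by
  obtain ⟨h, hh⟩ := hg.hasRightInverse
  let z : ℤ → Y := fun i => Int.casesOn i (fun n => g^[n] y) (fun n => h^[n + 1] y)
  have hz : ∀ i, z (i + 1) = g (z i) := by
    rintro (n | n)
    · exact Function.iterate_succ_apply' g n y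
    · cases n with
      | zero => exact (hh y).symm
      | succ n =>
        change h^[n + 1] y = g (h^[n + 1 + 1] y)
        rw [Function.iterate_succ_apply' h (n + 1), hh]
  refine ⟨⟨fun i => Sum.inl (z i), fun i y y' h h' => ?_⟩, ?_, rfl⟩
  · rw [← Sum.inl.inj h, ← Sum.inl.inj h', hz]
  · rintro ⟨i, hi⟩
    simp at hi

theorem exists_eq_inl {x : BrokenOrbit g} (hx : ¬ HasBreak x) (i : ℤ) : ∃ y, x i = Sum.inl y := by
  cases h : x i with
  | inl y => exact ⟨y, rfl⟩
  | inr b => exact (hx ⟨i, by simp [h]⟩).elim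

/-- Two sequences represent the same point if they are equal, or if both are unbroken and their
entries at `0` agree. -/
def Same (x x' : BrokenOrbit g) : Prop :=
  x = x' ∨ (¬ HasBreak x ∧ ¬ HasBreak x' ∧ x 0 = x' 0)

/-- The entry at 1 of an unbroken sequence is `g` of the entry at 0. This lets the forward shift
descend to the quotient. -/
theorem Same.shift_one {x x' : BrokenOrbit g} (h : Same x x') : Same (shift 1 x) (shift 1 x') := by
  obtain rfl | ⟨h1, h2, h0⟩ := h
  · exact Or.inl rfl
  · refine Or.inr ⟨by simpa, by simpa, ?_⟩
    obtain ⟨y, hy⟩ := exists_eq_inl h1 0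
    obtain ⟨z, hz⟩ := exists_eq_inl h1 (0 + 1)
    obtain ⟨z', hz'⟩ := exists_eq_inl h2 (0 + 1)
    rw [shift_apply, shift_apply, hz, hz', x.2 0 y z hy hz, x'.2 0 y z' (h0 ▸ hy) hz']

theorem Same.eq_of_hasBreak {x x' : BrokenOrbit g} (h : Same x x') (hx : HasBreak x') : x = x' :=
  h.resolve_right fun H => H.2.1 hx

/-- The map that remembers the entry at `0`, and the whole sequence if there is a break. -/
def collapse (x : BrokenOrbit g) : (Y ⊕ Bool) × (ℤ × ℤ → (Y ⊕ Bool) ⊕ Unit) :=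
  (x 0, fun p => if (x p.2).isRight then Sum.inl (x p.1) else Sum.inr ())

theorem collapse_eq_iff {x x' : BrokenOrbit g} : collapse x = collapse x' ↔ Same x x' := by
  constructor
  · intro h
    have h0 : x 0 = x' 0 := congrArg Prod.fst h
    have h1 (i j : ℤ) : (if (x j).isRight then Sum.inl (x i) else Sum.inr () :
        (Y ⊕ Bool) ⊕ Unit) = if (x' j).isRight then Sum.inl (x' i) else Sum.inr () :=
      congrFun (congrArg Prod.snd h) (i, j)
    by_cases hx : HasBreak x
    · obtain ⟨j, hj⟩ := hx
      left
      ext i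
      have := h1 i j
      rw [if_pos hj] at this
      split_ifs at this
      exact Sum.inl.inj this
    · refine Or.inr ⟨hx, ?_, h0⟩
      rintro ⟨j, hj⟩
      have := h1 0 j
      rw [if_pos hj, if_neg fun H => hx ⟨j, H⟩] at this
      cases this
  · rintro (rfl | ⟨h1, h2, h0⟩)
    · rfl
    · refine Prod.ext h0 (funext fun p => ?_)
      simp only [collapse]
      rw [if_neg fun H => h1 ⟨_, H⟩, if_neg fun H => h2 ⟨_, H⟩]

section Topology

variable [TopologicalSpace Y]

instance : TopologicalSpace (BrokenOrbit g) := instTopologicalSpaceSubtype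

theorem continuous_apply (i : ℤ) : Continuous fun x : BrokenOrbit g => x i :=
  (_root_.continuous_apply i).comp continuous_subtype_val

theorem continuous_shift (j : ℤ) : Continuous (shift j : BrokenOrbit g → BrokenOrbit g) :=
  Continuous.subtype_mk (continuous_pi fun i => continuous_apply (i + j)) _

instance [T2Space Y] : T2Space (BrokenOrbit g) := inferInstanceAs (T2Space (Subtype _))

instance [SecondCountableTopology Y] : SecondCountableTopology (BrokenOrbit g) :=
  Topology.IsInducing.subtypeVal.secondCountableTopology

theorem isClosed_setOf [T2Space Y] (hg : Continuous g) :
    IsClosed {x : ℤ → Y ⊕ Bool |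
      ∀ i y y', x i = Sum.inl y → x (i + 1) = Sum.inl y' → y' = g y} := by
  let R : Set ((Y ⊕ Bool) × (Y ⊕ Bool)) :=
    {p | ∀ y y', p.1 = Sum.inl y → p.2 = Sum.inl y' → y' = g y}
  have hR : IsClosed R := by
    -- A forbidden pair has both entries in `Y`, and `Y × Y` is open in the square of `Y ⊕ Bool`.
    have : Rᶜ = Prod.map Sum.inl Sum.inl '' {p : Y × Y | p.2 ≠ g p.1} := by
      ext ⟨a, b⟩
      simp only [R, mem_compl_iff, mem_ofPred_eq, not_forall, mem_image, Prod.exists, Prod.map_apply,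
        Prod.mk.injEq]
      constructor
      · rintro ⟨y, y', h, h', hn⟩
        exact ⟨y, y', hn, h.symm, h'.symm⟩
      · rintro ⟨y, y', hn, h, h'⟩
        exact ⟨y, y', h.symm, h'.symm, hn⟩
    rw [← isOpen_compl_iff, this]
    exact (Topology.IsOpenEmbedding.inl.prodMap Topology.IsOpenEmbedding.inl).isOpenMap _
      (isOpen_ne_fun continuous_snd (hg.comp continuous_fst))
  rw [ofPred_forall]
  refine isClosed_iInter fun i => ?_
  have := hR.preimage (f := fun x : ℤ → Y ⊕ Bool => (x i, x (i + 1)))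
    ((_root_.continuous_apply i).prodMk (_root_.continuous_apply (i + 1)))
  exact this

theorem compactSpace [CompactSpace Y] [T2Space Y] (hg : Continuous g) :
    CompactSpace (BrokenOrbit g) :=
  isCompact_iff_compactSpace.1 (isClosed_setOf hg).isCompact

theorem isClopen_isRight : IsClopen {a : Y ⊕ Bool | a.isRight} := by
  have : {a : Y ⊕ Bool | a.isRight} = range Sum.inr := by
    ext a
    cases a <;> simp
  rw [this]
  exact isClopen_range_inr

theorem isClosed_setOf_not_hasBreak : IsClosed {x : BrokenOrbit g | ¬ HasBreak x} := by
  simp only [HasBreak, not_exists, ofPred_forall]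
  exact isClosed_iInter fun i => isClopen_isRight.compl.isClosed.preimage (continuous_apply i)

/-- Having a break at a given place is a clopen condition, so the two branches never meet at a
frontier. -/
theorem continuous_collapse : Continuous (collapse : BrokenOrbit g → _) := by
  refine (continuous_apply 0).prodMk (continuous_pi fun p => ?_)
  refine Continuous.if (fun a ha => ?_) (continuous_inl.comp (continuous_apply _)) continuous_const
  have : IsClopen {x : BrokenOrbit g | (x p.2).isRight} :=
    isClopen_isRight.preimage (continuous_apply p.2)
  rw [this.frontier_eq] at ha
  exact ha.elim

end Topology

/-- The quotient is realized as the range of `collapse` in a countable product, from which it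
inherits metrizability and total disconnectedness. -/
theorem exists_quotient [MetricSpace Y] [CompactSpace Y] [TotallyDisconnectedSpace Y]
    (hg : Continuous g) :
    ∃ (X : Type u) (_ : MetricSpace X) (Φ : BrokenOrbit g → X), TotallyDisconnectedSpace X ∧
      Continuous Φ ∧ Function.Surjective Φ ∧ ∀ x x', Φ x = Φ x' ↔ Same x x' := by
  have := compactSpace hg
  let R : Set ((Y ⊕ Bool) × (ℤ × ℤ → (Y ⊕ Bool) ⊕ Unit)) :=
    range (collapse : BrokenOrbit g → _)
  have : CompactSpace R := isCompact_iff_compactSpace.1 (isCompact_range continuous_collapse)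
  refine ⟨R, TopologicalSpace.metrizableSpaceMetric R, rangeFactorization collapse, inferInstance,
    continuous_collapse.rangeFactorization, rangeFactorization_surjective, fun x x' => ?_⟩
  rw [← collapse_eq_iff]
  exact Subtype.ext_iff

/-- A continuous map into a metric space depends, up to `ε`, on finitely many entries only. -/
theorem exists_dist_lt_of_eqOn [TopologicalSpace Y] [T2Space Y] [CompactSpace (BrokenOrbit g)]
    {X : Type*} [MetricSpace X] {Φ : BrokenOrbit g → X} (hΦ : Continuous Φ) {ε : ℝ} (hε : 0 < ε) :
    ∃ n : ℕ, ∀ x x' : BrokenOrbit g, (∀ i : ℤ, |i| ≤ n → x i = x' i) → dist (Φ x) (Φ x') < ε := by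
  let E : ℕ → Set (BrokenOrbit g × BrokenOrbit g) :=
    fun n => {p | ∀ i : ℤ, |i| ≤ n → p.1 i = p.2 i}
  have hE (n) : IsClosed (E n) := by
    simp only [E, ofPred_forall]
    exact isClosed_iInter fun i => isClosed_iInter fun _ =>
      isClosed_eq ((continuous_apply i).comp continuous_fst)
        ((continuous_apply i).comp continuous_snd)
  have hanti : Antitone E := fun m n h p hp i hi => hp i (hi.trans (by exact_mod_cast h))
  let U : Set (BrokenOrbit g × BrokenOrbit g) := {p | dist (Φ p.1) (Φ p.2) < ε}
  have hU : IsOpen U := isOpen_lt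
    ((hΦ.comp continuous_fst).dist (hΦ.comp continuous_snd)) continuous_const
  -- The compact sets `E n` decrease to the diagonal, so one of them already lies in its open
  -- neighbourhood `U`.
  obtain ⟨n, hn⟩ := exists_subset_nhds_of_isCompact' (directed_of_isDirected_le hanti)
    (fun n => (hE n).isCompact) hE (U := U) (fun p hp => hU.mem_nhds (by
      have : p.1 = p.2 := ext fun i => mem_iInter.1 hp i.natAbs i (by simp)
      simpa [U, this] using hε))
  exact ⟨n, fun x x' h => hn (show (x, x') ∈ E n from h)⟩

/-- A neighbourhood in the space of sequences restricts finitely many entries only. -/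
theorem exists_mem_of_eqOn [TopologicalSpace Y] {U : Set (BrokenOrbit g)} (hU : IsOpen U)
    {x : BrokenOrbit g} (hx : x ∈ U) :
    ∃ (n : ℕ), ∃ V : Set (BrokenOrbit g), IsOpen V ∧ x ∈ V ∧
      ∀ z ∈ V, ∀ z' : BrokenOrbit g, (∀ i : ℤ, |i| ≤ n → z' i = z i) → z' ∈ U := by
  obtain ⟨O, hO, rfl⟩ := isOpen_induced_iff.1 hU
  obtain ⟨I, u, hu, hsub⟩ := isOpen_pi_iff.1 hO _ hx
  refine ⟨I.sup Int.natAbs, ⋂ i ∈ I, {z | z i ∈ u i}, isOpen_biInter_finset fun i hi =>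
    (hu i hi).1.preimage (continuous_apply i), mem_iInter₂.2 fun i hi => (hu i hi).2,
    fun z hz z' h => hsub fun i hi => ?_⟩
  rw [h i (by
    rw [Int.abs_eq_natAbs]
    exact_mod_cast Finset.le_sup (f := Int.natAbs) hi)]
  exact mem_iInter₂.1 hz i hi

end BrokenOrbit

/-! ### Recursive construction of the transitive orbits -/

namespace BrokenOrbit

variable {Y : Type u} {g : Y → Y}

/-- Stage `k` of the construction of a sequence that depends on the bits `s`. Stage `k + 1` keeps
stage `k` on the window of radius `13 ^ k`, and adds on either side a copy of this window, the
window of radius `k` of `D k`, and a mark: `true` on the right and `s k` on the left. -/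
def stage (D : ℕ → BrokenOrbit g) (s : ℕ → Bool) : ℕ → ℤ → Y ⊕ Bool
  | 0, _ => Sum.inr false
  | k + 1, i =>
    if |i| ≤ 13 ^ k then stage D s k i
    else if |i - 4 * 13 ^ k| ≤ 13 ^ k then stage D s k (i - 4 * 13 ^ k)
    else if |i + 4 * 13 ^ k| ≤ 13 ^ k then stage D s k (i + 4 * 13 ^ k)
    else if |i - 7 * 13 ^ k| ≤ k then D k (i - 7 * 13 ^ k)
    else if |i + 7 * 13 ^ k| ≤ k then D k (i + 7 * 13 ^ k)
    else if i = 9 * 13 ^ k then Sum.inr true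
    else if i = -(9 * 13 ^ k) then Sum.inr (s k)
    else Sum.inr false

variable (D : ℕ → BrokenOrbit g) (s : ℕ → Bool)

theorem natCast_lt_thirteen_pow (k : ℕ) : (k : ℤ) < 13 ^ k := by
  exact_mod_cast Nat.lt_pow_self (by norm_num)

/-- As k < 13^k, the copies and words are separated by gaps filled with breaks, so two adjacent
entries in `Y` belong to the same piece. -/
theorem eq_of_stage_eq_inl (k : ℕ) (i : ℤ) (y y' : Y) (h : stage D s k i = Sum.inl y)
    (h' : stage D s k (i + 1) = Sum.inl y') : y' = g y := by
  induction k generalizing i with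
  | zero => cases h
  | succ k ih =>
    have hk := natCast_lt_thirteen_pow k
    rw [stage] at h h'
    generalize (13 : ℤ) ^ k = L at *
    have e1 : i + 1 - 4 * L = i - 4 * L + 1 := by ring
    have e2 : i + 1 + 4 * L = i + 4 * L + 1 := by ring
    have e3 : i + 1 - 7 * L = i - 7 * L + 1 := by ring
    have e4 : i + 1 + 7 * L = i + 7 * L + 1 := by ring
    rw [e1, e2, e3, e4] at h'
    simp only [abs_le] at h h'
    split_ifs at h <;> first
      | cases h
      | (split_ifs at h' <;> first
          | cases h'
          | exact ih _ h h'
          | exact (D k).2 _ _ _ h h'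
          | omega)

theorem stage_eq_of_le {k m : ℕ} (hkm : k ≤ m) {i : ℤ} (hi : |i| ≤ 13 ^ k) :
    stage D s m i = stage D s k i := by
  induction m, hkm using Nat.le_induction with
  | base => rfl
  | succ m hm ih =>
    rw [stage, if_pos (hi.trans (pow_le_pow_right₀ (by norm_num) hm)), ih]

/-- The limit of the stages. -/
def limitOrbit : BrokenOrbit g :=
  ⟨fun i => stage D s i.natAbs i, fun i y y' h h' => by
    -- The entries at i and i + 1 may be defined at different stages; both can be read at stage |i|
    -- + 1.
    have hb (j : ℤ) (hj : j.natAbs ≤ i.natAbs + 1) :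
        stage D s j.natAbs j = stage D s (i.natAbs + 1) j :=
      (stage_eq_of_le D s hj ((Int.abs_eq_natAbs j).trans_le (natCast_lt_thirteen_pow _).le)).symm
    replace h := (hb i (by omega)).symm.trans h
    replace h' := (hb (i + 1) (by omega)).symm.trans h'
    exact eq_of_stage_eq_inl D s _ i y y' h h'⟩

theorem limitOrbit_apply {k : ℕ} {i : ℤ} (hi : |i| ≤ 13 ^ k) :
    limitOrbit D s i = stage D s k i := by
  change stage D s i.natAbs i = _
  have h : |i| ≤ 13 ^ i.natAbs := (Int.abs_eq_natAbs i).trans_le (natCast_lt_thirteen_pow _).le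
  rw [← stage_eq_of_le D s (le_max_left _ k) h, stage_eq_of_le D s (le_max_right _ k) hi]

theorem limitOrbit_apply_succ {k : ℕ} {i : ℤ} (hi : |i| ≤ 13 * 13 ^ k) :
    limitOrbit D s i = stage D s (k + 1) i :=
  limitOrbit_apply D s (by rwa [pow_succ'])

theorem limitOrbit_add {k : ℕ} {i : ℤ} (hi : |i| ≤ 13 ^ k) :
    limitOrbit D s (i + 4 * 13 ^ k) = limitOrbit D s i := by
  have hk := natCast_lt_thirteen_pow k
  rw [limitOrbit_apply D s hi, limitOrbit_apply_succ D s (k := k), stage]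
  · generalize hL : (13 : ℤ) ^ k = L at *
    rw [abs_le] at hi
    rw [if_neg (by rw [abs_le]; omega), if_pos (by rw [abs_le]; omega), add_sub_cancel_right]
  · rw [abs_le] at *
    omega

theorem limitOrbit_sub {k : ℕ} {i : ℤ} (hi : |i| ≤ 13 ^ k) :
    limitOrbit D s (i - 4 * 13 ^ k) = limitOrbit D s i := by
  have hk := natCast_lt_thirteen_pow k
  rw [limitOrbit_apply D s hi, limitOrbit_apply_succ D s (k := k), stage]
  · generalize hL : (13 : ℤ) ^ k = L at *
    rw [abs_le] at hi
    rw [if_neg (by rw [abs_le]; omega), if_neg (by rw [abs_le]; omega),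
      if_pos (by rw [abs_le]; omega), sub_add_cancel]
  · rw [abs_le] at *
    omega

theorem limitOrbit_word_right {k : ℕ} {i : ℤ} (hi : |i| ≤ k) :
    limitOrbit D s (i + 7 * 13 ^ k) = D k i := by
  have hk := natCast_lt_thirteen_pow k
  rw [limitOrbit_apply_succ D s (k := k), stage]
  · generalize hL : (13 : ℤ) ^ k = L at *
    rw [abs_le] at hi
    rw [if_neg (by rw [abs_le]; omega), if_neg (by rw [abs_le]; omega),
      if_neg (by rw [abs_le]; omega), if_pos (by rw [abs_le]; omega), add_sub_cancel_right]
  · rw [abs_le] at *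
    omega

theorem limitOrbit_word_left {k : ℕ} {i : ℤ} (hi : |i| ≤ k) :
    limitOrbit D s (i - 7 * 13 ^ k) = D k i := by
  have hk := natCast_lt_thirteen_pow k
  rw [limitOrbit_apply_succ D s (k := k), stage]
  · generalize hL : (13 : ℤ) ^ k = L at *
    rw [abs_le] at hi
    rw [if_neg (by rw [abs_le]; omega), if_neg (by rw [abs_le]; omega),
      if_neg (by rw [abs_le]; omega), if_neg (by rw [abs_le]; omega),
      if_pos (by rw [abs_le]; omega), sub_add_cancel]
  · rw [abs_le] at *
    omega

/-- Beyond the words, which end before 8L, only the marks interrupt the run of `false`. This serves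
both proximality and the rigidity of the origin. -/
theorem limitOrbit_eq_false {k : ℕ} {i : ℤ} (h1 : 8 * 13 ^ k ≤ |i|) (h2 : |i| ≤ 13 * 13 ^ k)
    (h3 : |i| ≠ 9 * 13 ^ k) : limitOrbit D s i = Sum.inr false := by
  have hk := natCast_lt_thirteen_pow k
  rw [limitOrbit_apply_succ D s h2, stage]
  generalize hL : (13 : ℤ) ^ k = L at *
  simp only [abs_eq_max_neg] at h1 h2 h3
  simp only [abs_le]
  split_ifs <;> first | rfl | omega

theorem limitOrbit_mark_right (k : ℕ) : limitOrbit D s (9 * 13 ^ k) = Sum.inr true := by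
  have hk := natCast_lt_thirteen_pow k
  rw [limitOrbit_apply_succ D s (k := k), stage]
  · generalize hL : (13 : ℤ) ^ k = L at *
    simp only [abs_le]
    split_ifs <;> first | rfl | omega
  · rw [abs_le]
    omega

theorem limitOrbit_mark_left (k : ℕ) : limitOrbit D s (-(9 * 13 ^ k)) = Sum.inr (s k) := by
  have hk := natCast_lt_thirteen_pow k
  rw [limitOrbit_apply_succ D s (k := k), stage]
  · generalize hL : (13 : ℤ) ^ k = L at *
    simp only [abs_le]
    split_ifs <;> first | rfl | omega
  · rw [abs_le]
    omega

theorem hasBreak_limitOrbit : HasBreak (limitOrbit D s) :=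
  ⟨_, by rw [limitOrbit_mark_right D s 0]; rfl⟩

/-- If i > j, compare at the mark `true` at 9L of the right-hand sequence, with L = 13^(i - j): the
left-hand one is read at a place strictly between 9L and 10L, where it is `false`. -/
theorem le_of_shift_limitOrbit_eq {D : ℕ → BrokenOrbit g} {s t : ℕ → Bool} {i j : ℤ}
    (h : shift i (limitOrbit D s) = shift j (limitOrbit D t)) : i ≤ j := by
  by_contra! hij
  have hk := natCast_lt_thirteen_pow (i - j).natAbs
  have := congrArg (fun x : BrokenOrbit g => x (9 * 13 ^ (i - j).natAbs - j)) h
  simp only [shift_apply, sub_add_cancel, limitOrbit_mark_right] at this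
  rw [limitOrbit_eq_false D s (k := (i - j).natAbs)] at this
  · cases this
  all_goals
    generalize hL : (13 : ℤ) ^ (i - j).natAbs = L at *
    simp only [abs_eq_max_neg]
    omega

theorem eq_of_shift_limitOrbit_eq {D : ℕ → BrokenOrbit g} {s t : ℕ → Bool} {i j : ℤ}
    (h : shift i (limitOrbit D s) = shift j (limitOrbit D t)) : i = j ∧ s = t := by
  obtain rfl := (le_of_shift_limitOrbit_eq h).antisymm (le_of_shift_limitOrbit_eq h.symm)
  refine ⟨rfl, funext fun k => ?_⟩
  have := congrArg (fun x : BrokenOrbit g => x (-(9 * 13 ^ k) - i)) h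
  simp only [shift_apply, sub_add_cancel, limitOrbit_mark_left] at this
  exact Sum.inr.inj this

theorem continuous_stage [TopologicalSpace Y] (k : ℕ) (i : ℤ) :
    Continuous fun s => stage D s k i := by
  induction k generalizing i with
  | zero => exact continuous_const
  | succ k ih =>
    simp only [stage]
    split_ifs <;> first
      | exact ih _
      | exact continuous_const
      | exact continuous_inr.comp (_root_.continuous_apply k)

theorem continuous_limitOrbit [TopologicalSpace Y] : Continuous (limitOrbit D) :=
  continuous_induced_rng.2 (continuous_pi fun i => continuous_stage D i.natAbs i)

theorem exists_frequently_dense [TopologicalSpace Y]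
    [TopologicalSpace.SeparableSpace (BrokenOrbit g)] :
    ∃ D : ℕ → BrokenOrbit g, ∀ V : Set (BrokenOrbit g), IsOpen V → V.Nonempty →
      ∀ m : ℕ, ∃ k ≥ m, D k ∈ V := by
  have : Nonempty (BrokenOrbit g) := ⟨allFalse g⟩
  -- Unpairing the index repeats each term of a dense sequence infinitely often.
  refine ⟨fun k => TopologicalSpace.denseSeq _ k.unpair.1, fun V hV hne m => ?_⟩
  obtain ⟨_, hx, n, rfl⟩ := (TopologicalSpace.denseRange_denseSeq _).inter_open_nonempty V hV hne
  exact ⟨Nat.pair n m, Nat.right_le_pair n m, by simpa using hx⟩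

/-- The shifts of the limit sequences form a chaotic family in the quotient. -/
theorem isChaoticFamily [MetricSpace Y] [CompactSpace Y] (hg : Continuous g)
    {X : Type u} [MetricSpace X] {f : X → X} {Φ : BrokenOrbit g → X} (hΦ : Continuous Φ)
    (hsurj : Function.Surjective Φ) (hsame : ∀ x x', Φ x = Φ x' ↔ Same x x')
    (hf : ∀ x, f (Φ x) = Φ (shift 1 x))
    (hD : ∀ V : Set (BrokenOrbit g), IsOpen V → V.Nonempty → ∀ m : ℕ, ∃ k ≥ m, D k ∈ V) :
    IsChaoticFamily f fun i s => Φ (shift i (limitOrbit D s)) where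
  continuous i := hΦ.comp ((continuous_shift i).comp (continuous_limitOrbit D))
  injective i j s t h := eq_of_shift_limitOrbit_eq
    (((hsame _ _).1 h).eq_of_hasBreak (by simpa using hasBreak_limitOrbit D t))
  map_eq i s := by rw [hf, shift_shift, add_comm]
  eq_of_map_eq i s y h := by
    obtain ⟨x, rfl⟩ := hsurj y
    rw [hf] at h
    have := ((hsame _ _).1 h).eq_of_hasBreak (by simpa using hasBreak_limitOrbit D s)
    have := congrArg (shift (-1)) this
    rw [shift_shift, shift_shift, neg_add_cancel, shift_zero, neg_add_eq_sub, add_sub_cancel_right]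
      at this
    rw [this]
  recurrent ε hε N m := by
    have := compactSpace hg
    obtain ⟨n, hn⟩ := exists_dist_lt_of_eqOn hΦ hε
    -- k ≥ n + N keeps i + j inside the repeated block of radius 13^k, and k ≥ m makes the return
    -- time exceed m.
    let k := n + N + m
    have hk := natCast_lt_thirteen_pow k
    refine ⟨4 * 13 ^ k, by zify; omega, fun i s hi => ⟨hn _ _ fun j hj => ?_, hn _ _ fun j hj => ?_⟩⟩
    · simp only [shift_apply, Nat.cast_mul, Nat.cast_pow, Nat.cast_ofNat]
      rw [← add_assoc, limitOrbit_add]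
      simp only [abs_eq_max_neg] at *
      omega
    · simp only [shift_apply, Nat.cast_mul, Nat.cast_pow, Nat.cast_ofNat]
      rw [← add_sub_assoc, limitOrbit_sub]
      simp only [abs_eq_max_neg] at *
      omega
  proximal := by
    refine ⟨Φ (allFalse g), fun ε hε N m => ?_⟩
    have := compactSpace hg
    obtain ⟨n, hn⟩ := exists_dist_lt_of_eqOn hΦ hε
    let k := n + N + m
    have hk := natCast_lt_thirteen_pow k
    -- Since |i + j| < 13^k, all entries read lie within 13^k of ±11·13^k, past the marks and within
    -- the extended block.
    refine ⟨11 * 13 ^ k, by zify; omega, fun i s hi => ⟨hn _ _ fun j hj => ?_, hn _ _ fun j hj => ?_⟩⟩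
    all_goals
      simp only [shift_apply, Nat.cast_mul, Nat.cast_pow, Nat.cast_ofNat]
      rw [limitOrbit_eq_false D s (k := k)]
      · rfl
      all_goals
        generalize (13 : ℤ) ^ k = L at *
        simp only [abs_eq_max_neg] at *
        omega
  transitive U hU hne s m := by
    obtain ⟨y, hy⟩ := hne
    obtain ⟨x, rfl⟩ := hsurj y
    obtain ⟨n, V, hV, hxV, h⟩ := exists_mem_of_eqOn (hU.preimage hΦ) hy
    -- k ≥ n makes the word cover the restricted entries, and k ≥ |m| puts its two occurrences on
    -- either side of m.
    obtain ⟨k, hkm, hkV⟩ := hD V hV ⟨x, hxV⟩ (n + m.natAbs)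
    have hk := natCast_lt_thirteen_pow k
    refine ⟨⟨7 * 13 ^ k, by omega, h _ hkV _ fun i hi => ?_⟩,
      ⟨-(7 * 13 ^ k), by omega, h _ hkV _ fun i hi => ?_⟩⟩
    · rw [shift_apply, limitOrbit_word_right]
      omega
    · rw [shift_apply, ← sub_eq_add_neg, limitOrbit_word_left]
      omega

/-! ### The embedded copy of Y and the final assembly -/

/-- The copy of the phase space of `g` in the quotient. -/
theorem exists_embedding [MetricSpace Y] [CompactSpace Y] (hg : Continuous g)
    (hgs : Function.Surjective g)
    {X : Type u} [MetricSpace X] {f : X → X} {Φ : BrokenOrbit g → X} (hΦ : Continuous Φ)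
    (hsame : ∀ x x', Φ x = Φ x' ↔ Same x x') (hf : ∀ x, f (Φ x) = Φ (shift 1 x)) :
    ∃ ι : Y → X, Topology.IsEmbedding ι ∧ Function.Semiconj ι g f ∧
      ∀ x, Φ x ∈ range ι ↔ ¬ HasBreak x := by
  have := compactSpace hg
  -- The full orbit `o y` is an arbitrary choice, but its class depends only on `y`.
  choose o ho ho' using exists_apply_zero_eq hgs
  have key {x : BrokenOrbit g} (hx : ¬ HasBreak x) {y : Y} (hy : x 0 = Sum.inl y) :
      Φ (o y) = Φ x := (hsame _ _).2 (Or.inr ⟨ho y, hx, (ho' y).trans hy.symm⟩)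
  have hcont : Continuous fun y => Φ (o y) := by
    refine continuous_iff_isClosed.2 fun F hF => ?_
    -- No continuity of `o` is available; instead the preimage of a closed set comes from projecting
    -- a compact set of unbroken sequences to the entry at 0.
    have : (fun y => Φ (o y)) ⁻¹' F = Sum.inl ⁻¹'
        ((fun x : BrokenOrbit g => x 0) '' ({x | ¬ HasBreak x} ∩ Φ ⁻¹' F)) := by
      ext y
      constructor
      · exact fun h => ⟨o y, ⟨ho y, h⟩, ho' y⟩
      · rintro ⟨x, ⟨hx, hxF⟩, hxy⟩
        rw [mem_preimage, key hx hxy]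
        exact hxF
    rw [this]
    exact ((isClosed_setOf_not_hasBreak.inter (hF.preimage hΦ)).isCompact.image
      (continuous_apply 0)).isClosed.preimage continuous_inl
  have hinj : Function.Injective fun y => Φ (o y) := by
    intro y y' h
    have h0 : o y 0 = o y' 0 := by
      obtain h | h := (hsame _ _).1 h
      · rw [h]
      · exact h.2.2
    rw [ho', ho'] at h0
    exact Sum.inl.inj h0
  refine ⟨_, (hcont.isClosedEmbedding hinj).isEmbedding, fun y => ?_, fun x => ⟨?_, fun hx => ?_⟩⟩
  · change Φ (o (g y)) = f (Φ (o y))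
    rw [hf]
    have hb : ¬ HasBreak (shift 1 (o y)) := by simpa using ho y
    obtain ⟨z, hz⟩ := exists_eq_inl (ho y) (0 + 1)
    rw [← (o y).2 0 y z (ho' y) hz]
    exact key hb hz
  · rintro ⟨y, hy⟩ hx
    exact ho y (((hsame _ _).1 hy).eq_of_hasBreak hx ▸ hx)
  · obtain ⟨y, hy⟩ := exists_eq_inl hx 0
    exact ⟨y, key hx hy⟩

end BrokenOrbit

/-- A continuous self-map of a compact Hausdorff space that is bijective on a set which is its own
preimage restricts to a homeomorphism of that set. -/
theorem exists_homeomorph_of_preimage_eq {X : Type u} [TopologicalSpace X] [CompactSpace X]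
    [T2Space X] {f : X → X} (hf : Continuous f) {W : Set X} (hW : f ⁻¹' W = W)
    (hbij : BijOn f W W) : ∃ h : W ≃ₜ W, ∀ x, (h x : X) = f x := by
  have hmaps : MapsTo f W W := hbij.mapsTo
  have hclosed : IsClosedMap (hmaps.restrict f W W) := by
    intro F hF
    obtain ⟨F', hF', rfl⟩ := isClosed_induced_iff.1 hF
    refine isClosed_induced_iff.2 ⟨f '' F', hf.isClosedMap _ hF', ?_⟩
    ext ⟨y, hy⟩
    constructor
    · rintro ⟨x, hx, rfl⟩
      have hxW : x ∈ W := by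
        rw [← hW]
        exact hy
      exact ⟨⟨x, hxW⟩, hx, rfl⟩
    · rintro ⟨x, hx, hxy⟩
      exact ⟨x, hx, congrArg Subtype.val hxy⟩
  have : IsHomeomorph (hmaps.restrict f W W) :=
    isHomeomorph_iff_continuous_isClosedMap_bijective.2
      ⟨hf.restrict hmaps, hclosed, hbij.bijective⟩
  exact ⟨this.homeomorph, fun x => rfl⟩

open BrokenOrbit in
/-- The system `X` consists of the sequences of orbit pieces of `g` separated by breaks, with the
unbroken ones collapsed to their entry at `0`. Points of `X` outside the copy of `Y` may leave a
neighbourhood of `Y` at one place and return to it at any other, which is why this extension exists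
even when `g` is not chain transitive: the hypothesis `hct` is not needed. -/
theorem mainTheorem1 {Y : Type u} [MetricSpace Y] (g : Y → Y)
    (hg : IsZeroDimSystem g) (hct : IsChainTransitive g) :
    ∃ (X : Type u) (_ : MetricSpace X) (f : X → X) (ι : Y → X) (K : Set X) (C : ℕ → Set X),
      IsZeroDimSystem f ∧
      -- `ι` embeds `(Y, g)` in `(X, f)`
      Topology.IsEmbedding ι ∧ Function.Semiconj ι g f ∧
      -- `(X, f)` is densely uniformly chaotic, with uniformly chaotic set `K` in `X ∖ Y`
      IsDenselyUniformlyChaotic f ∧ IsUniformlyChaoticSet f K ∧ K ⊆ (range ι)ᶜ ∧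
      -- `f` restricts to a homeomorphism of `X ∖ Y` onto itself
      (∃ h : ((range ι)ᶜ : Set X) ≃ₜ ((range ι)ᶜ : Set X), ∀ x, (h x : X) = f x) ∧
      -- `K` is an increasing union of Cantor sets
      Monotone C ∧ (∀ N, IsCantorSet (C N)) ∧ K = ⋃ N, C N ∧
      (∀ N, IsUniformlyProximal f (C N) ∧ IsNegUniformlyProximal f (C N)) ∧
      (∀ N, IsUniformlyRecurrent f (C N) ∧ IsNegUniformlyRecurrent f (C N)) ∧
      f '' K = K ∧
      Dense K ∧
      (∀ x ∈ K, IsPosTransitivePoint f x ∧ IsNegTransitivePoint f x) := by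
  have := hg.compactSpace
  have := hg.totallyDisconnectedSpace
  have := BrokenOrbit.compactSpace hg.continuous
  obtain ⟨X, _, Φ, _, hΦ, hsurj, hsame⟩ := exists_quotient hg.continuous
  have hex (y : X) : ∃ z, ∀ x, Φ x = y → Φ (shift 1 x) = z := by
    obtain ⟨x, rfl⟩ := hsurj y
    exact ⟨_, fun x' h => (hsame _ _).2 ((hsame _ _).1 h).shift_one⟩
  choose f hf' using hex
  have hf (x) : f (Φ x) = Φ (shift 1 x) := (hf' _ x rfl).symm
  have : CompactSpace X := ⟨by
    rw [← hsurj.range_eq]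
    exact isCompact_range hΦ⟩
  have hfc : Continuous f := by
    refine (hΦ.isClosedMap.isQuotientMap hΦ hsurj).continuous_iff.2 ?_
    exact (hΦ.comp (continuous_shift 1)).congr fun x => (hf x).symm
  have hfs : Function.Surjective f := by
    intro y
    obtain ⟨x, rfl⟩ := hsurj y
    exact ⟨Φ (shift (-1) x), by simp [hf, shift_shift]⟩
  obtain ⟨D, hD⟩ := exists_frequently_dense (g := g)
  have hP := isChaoticFamily D hg.continuous hΦ hsurj hsame hf hD
  obtain ⟨ι, hι, hιf, hmem⟩ := exists_embedding hg.continuous hg.surjective hΦ hsame hf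
  have hpre : f ⁻¹' (range ι)ᶜ = (range ι)ᶜ := by
    ext y
    obtain ⟨x, rfl⟩ := hsurj y
    simp only [mem_preimage, mem_compl_iff, hf, hmem, hasBreak_shift]
  have hbij : BijOn f (range ι)ᶜ (range ι)ᶜ := by
    refine ⟨hpre.ge, ?_, fun y hy => ?_⟩
    · intro y hy y' hy' h
      obtain ⟨x, rfl⟩ := hsurj y
      obtain ⟨x', rfl⟩ := hsurj y'
      rw [hf, hf] at h
      rw [mem_compl_iff, hmem, not_not] at hy'
      -- A sequence with a break is alone in its class, so the shifted sequences are equal and can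
      -- be shifted back.
      have := congrArg (shift (-1)) (((hsame _ _).1 h).eq_of_hasBreak (by simpa using hy'))
      rw [shift_shift, shift_shift, neg_add_cancel, shift_zero, shift_zero] at this
      rw [this]
    · obtain ⟨z, rfl⟩ := hfs y
      exact ⟨z, hpre.le hy, rfl⟩
  refine ⟨X, _, f, ι, _, IsChaoticFamily.window fun i s => Φ (shift i (limitOrbit D s)),
    ⟨‹_›, ‹_›, hfc, hfs⟩, hι, hιf,
    ⟨_, hP.dense_range, hP.isUniformlyChaoticSet_range⟩, hP.isUniformlyChaoticSet_range, ?_,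
    exists_homeomorph_of_preimage_eq hfc hpre hbij, IsChaoticFamily.window_mono,
    hP.isCantorSet_window,
    (IsChaoticFamily.iUnion_window (P := fun i s => Φ (shift i (limitOrbit D s)))).symm,
    fun N => ⟨hP.isUniformlyProximal_window N, hP.isNegUniformlyProximal_window N⟩,
    fun N => ⟨hP.isUniformlyRecurrent_window N, hP.isNegUniformlyRecurrent_window N⟩,
    hP.image_range, hP.dense_range, ?_⟩
  · rintro _ ⟨⟨i, s⟩, rfl⟩
    rw [mem_compl_iff, hmem, not_not, hasBreak_shift]
    exact hasBreak_limitOrbit D s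
  · rintro _ ⟨⟨i, s⟩, rfl⟩
    exact ⟨hP.isPosTransitivePoint i s, hP.isNegTransitivePoint i s⟩
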